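/- Let $n,d\ge 1$ be integers. (1) For any points $w_1,\dots,w_n\in\mathbf R^d$, the origin is not in the convex hull of $w_1,\dots,w_n$ if and only if the points all lie in some open half-space $\{x:\langle v,x\rangle>0\}$ with $v\neq 0$. (2) Let $z_1,\dots,z_n$ be independent random points in $\mathbf R^d$ (not necessarily identically distributed), each of whose distributions has a density $f_i$ with respect to Lebesgue measure that is symmetric about the origin, $f_i(-x)=f_i(x)$. Then the probability that the origin is not in the convex hull of $z_1,\dots,z_n$ is $$p(n,d)=\frac1{2^{n-1}}\sum_{j=0}^{d-1}\binom{n-1}{j}.$$ Moreover, for $\varepsilon\in\{\pm1\}^n$ let $X_\varepsilon$ be $1$ if the points $\varepsilon_1z_1,\dots,\varepsilon_nz_n$ all lie in some open half-space $\{x:\langle v,x\rangle>0\}$ with $v\ne0$, and $0$ otherwise. Then almost surely $\sum_{\varepsilon\in\{\pm1\}^n}X_\varepsilon$ equals the number of regions cut out by the hyperplanes through the origin orthogonal to $z_1,\dots,z_n$ (the number of connected components of $\mathbf R^d\setminus\bigcup_{i}\{v:\langle v,z_i\rangle=0\}$), and this number is $2\sum_{j=0}^{d-1}\binom{n-1}{j}$.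 (3) The probability is unchanged when one of the points is fixed: if $z_k=a$ for some index $k$ (for instance $k=1$) and some fixed $a\neq0$, and the other points $z_i$, $i\ne k$, are independent random points whose distributions have densities symmetric about the origin, then the probability that the origin is not in the convex hull of $z_1,\dots,z_n$ is still $p(n,d)$. -/

import Mathlib

open MeasureTheory ProbabilityTheory

/-- `X` is a random point of `ℝ^d` whose distribution has a density (with respect to Lebesgue
measure) that is symmetric about the origin. -/
def HasSymmetricDensity {Ω : Type*} [MeasurableSpace Ω] {d : ℕ}
    (X : Ω → EuclideanSpace ℝ (Fin d)) (μ : Measure Ω) : Prop :=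
  Measurable X ∧ ∃ f : EuclideanSpace ℝ (Fin d) → ENNReal,
    Measurable f ∧ (∀ x, f (-x) = f x) ∧ μ.map X = volume.withDensity f

/-- The open half-space, bounded by a hyperplane through the origin, with inner normal `v`. -/
def openHalfSpace {d : ℕ} (v : EuclideanSpace ℝ (Fin d)) : Set (EuclideanSpace ℝ (Fin d)) :=
  {x | 0 < inner ℝ v x}

/-- The points `z i` all lie in some open half-space whose boundary contains the origin. -/
def LieInHalfSpace {n d : ℕ} (z : Fin n → EuclideanSpace ℝ (Fin d)) : Prop :=
  ∃ v : EuclideanSpace ℝ (Fin d), v ≠ 0 ∧ ∀ i, z i ∈ openHalfSpace v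

open Classical in
/-- The indicator `X_ε`: it is `1` if the points `ε i • z i` all lie in some half-space, and `0`
otherwise. The sign vector `ε` takes values in the units `{1, -1}` of `ℤ`. -/
noncomputable def halfSpaceIndicator {n d : ℕ} (ε : Fin n → ℤˣ)
    (z : Fin n → EuclideanSpace ℝ (Fin d)) : ℕ :=
  if LieInHalfSpace (fun i => ε i • z i) then 1 else 0

/-- The number of regions cut out by the hyperplanes through the origin orthogonal to the `z i`,
that is, of connected components of the complement of their union. -/
noncomputable def numRegions {n d : ℕ} (z : Fin n → EuclideanSpace ℝ (Fin d)) : ℕ :=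
  Nat.card (ConnectedComponents
    ↥((⋃ i, {v : EuclideanSpace ℝ (Fin d) | inner ℝ v (z i) = 0})ᶜ))

/-!
Wendel's theorem rests on a count that is the same for all configurations in general position.
For a vector `v` record the signs of `⟨v, z i⟩`: the points `ε i • z i` lie in a common half-space
exactly when `ε` is one of the sign vectors so realised, and the set of `v` realising a given `ε`
is an intersection of half-spaces, hence convex. As the sign vector is locally constant off the
hyperplanes, the regions of the arrangement correspond to the realised sign vectors
(`numRegions_eq_ncard_signPatterns`).

The number of realised sign vectors is found by deletion and restriction
(`ncard_signPatterns_succ`): a sign vector of the remaining functionals extends in both ways across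
the hyperplane `f 0 = 0` precisely when it is realised on that hyperplane. General position passes
to the hyperplane with the dimension lowered by one, so Pascal's rule gives
`2 * ∑ j < d, C(n - 1, j)` (`ncard_signPatterns`).

Almost surely the points are in general position (`ae_inGeneralPosition`): given fewer than `d`
points, the next one avoids their span, a null set, by Fubini. Sign changes preserve the joint law,
so every `ε` gives the same probability, and taking expectations of the count divides it by `2 ^ n`
(`measureReal_zero_notMem_convexHull`). When the `k`-th point is fixed, only sign vectors with
`ε k = 1` preserve the law, but negating the configuration does not affect the event and covers
the others.
-/

/-! ### Sign patterns of linear functionals -/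

/-- The sign vectors realised by a family of linear functionals: those `ε` for which some vector
`v` has `f i v` nonzero of sign `ε i` for all `i`. -/
def signPatterns {V ι : Type*} [AddCommGroup V] [Module ℝ V] (f : ι → Module.Dual ℝ V) :
    Set (ι → ℤˣ) :=
  {ε | ∃ v, ∀ i, 0 < ε i • f i v}

/-- General position up to size `d`: every subfamily of at most `d` members is linearly
independent. -/
def InGeneralPosition {M ι : Type*} [AddCommGroup M] [Module ℝ M] (d : ℕ) (f : ι → M) : Prop :=
  ∀ S : Finset ι, S.card ≤ d → LinearIndepOn ℝ f (S : Set ι)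

section Patterns

variable {V ι : Type*} [AddCommGroup V] [Module ℝ V]

lemma exists_pos_perturbation [Finite ι] {f : ι → Module.Dual ℝ V} {ε : ι → ℤˣ} {v : V}
    (hv : ∀ i, 0 < ε i • f i v) (u : V) :
    ∃ t : ℝ, 0 < t ∧ (∀ i, 0 < ε i • f i (v + t • u)) ∧ ∀ i, 0 < ε i • f i (v - t • u) := by
  have key : ∀ u : V, ∀ᶠ t : ℝ in nhdsWithin 0 (Set.Ioi 0), ∀ i, 0 < ε i • f i (v + t • u) := by
    intro u
    rw [Filter.eventually_all]
    intro i
    have hc : Continuous fun t : ℝ => ε i • f i v + t * (ε i • f i u) := by fun_prop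
    have h := (hc.tendsto 0).eventually_const_lt (u := 0) (by simpa using hv i)
    filter_upwards [h.filter_mono nhdsWithin_le_nhds] with t ht
    simpa [smul_add, mul_smul_comm] using ht
  obtain ⟨t, h1, h2, h3⟩ :=
    ((key u).and ((key (-u)).and self_mem_nhdsWithin)).exists
  exact ⟨t, h3, h1, fun i => by simpa [sub_eq_add_neg] using h2 i⟩

/-- A pattern of the remaining functionals is realised on the hyperplane `f 0 = 0` exactly when it
is realised on both sides of that hyperplane. -/
lemma mem_signPatterns_ker_iff {n : ℕ} {f : Fin (n + 1) → Module.Dual ℝ V} (h0 : f 0 ≠ 0)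
    (ε : Fin n → ℤˣ) :
    ε ∈ signPatterns (fun i : Fin n => (f i.succ).domRestrict (LinearMap.ker (f 0))) ↔
      (Fin.cons 1 ε : Fin (n + 1) → ℤˣ) ∈ signPatterns f ∧
        (Fin.cons (-1) ε : Fin (n + 1) → ℤˣ) ∈ signPatterns f := by
  constructor
  · rintro ⟨⟨v, hv0⟩, hv⟩
    rw [LinearMap.mem_ker] at hv0
    obtain ⟨u, hu⟩ : ∃ u, f 0 u = 1 := LinearMap.surjective h0 1
    obtain ⟨t, ht, h1, h2⟩ := exists_pos_perturbation (f := fun i : Fin n => f i.succ) hv u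
    exact ⟨⟨v + t • u, Fin.cases (by simpa [hv0, hu] using ht) (by simpa using h1)⟩,
      ⟨v - t • u, Fin.cases (by simpa [hv0, hu, Units.smul_def] using ht) (by simpa using h2)⟩⟩
  · rintro ⟨⟨v, hv⟩, w, hw⟩
    have hv0 : 0 < f 0 v := by simpa using hv 0
    have hw0 : f 0 w < 0 := by simpa [Units.smul_def] using hw 0
    -- The point where the segment from `v` to `w` crosses the hyperplane, up to scaling.
    refine ⟨⟨(-f 0 w) • v + (f 0 v) • w, by simp; ring⟩, fun i => ?_⟩
    have h1 : 0 < ε i • f i.succ v := by simpa using hv i.succ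
    have h2 : 0 < ε i • f i.succ w := by simpa using hw i.succ
    have : ε i • f i.succ ((-f 0 w) • v + (f 0 v) • w)
        = (-f 0 w) * (ε i • f i.succ v) + f 0 v * (ε i • f i.succ w) := by
      simp only [map_add, map_smul, smul_add, smul_eq_mul, mul_smul_comm]
    change 0 < ε i • f i.succ ((-f 0 w) • v + (f 0 v) • w)
    rw [this]
    exact add_pos (mul_pos (neg_pos.2 hw0) h1) (mul_pos hv0 h2)

lemma mem_signPatterns_tail_iff {n : ℕ} {f : Fin (n + 1) → Module.Dual ℝ V} (h0 : f 0 ≠ 0)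
    (ε : Fin n → ℤˣ) :
    ε ∈ signPatterns (fun i : Fin n => f i.succ) ↔
      (Fin.cons 1 ε : Fin (n + 1) → ℤˣ) ∈ signPatterns f ∨
        (Fin.cons (-1) ε : Fin (n + 1) → ℤˣ) ∈ signPatterns f := by
  constructor
  · rintro ⟨v, hv⟩
    rcases lt_trichotomy (f 0 v) 0 with h | h | h
    · exact .inr ⟨v, Fin.cases (by simpa [Units.smul_def] using h) (by simpa using hv)⟩
    · exact .inl ((mem_signPatterns_ker_iff h0 ε).1 ⟨⟨v, h⟩, hv⟩).1
    · exact .inl ⟨v, Fin.cases (by simpa using h) (by simpa using hv)⟩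
  · rintro (⟨v, hv⟩ | ⟨v, hv⟩) <;> exact ⟨v, fun i => by simpa using hv i.succ⟩

/-- Deletion–restriction: adjoining a nonzero functional `f 0` adds as many patterns as the other
functionals realise on its kernel. -/
lemma ncard_signPatterns_succ {n : ℕ} {f : Fin (n + 1) → Module.Dual ℝ V} (h0 : f 0 ≠ 0) :
    (signPatterns f).ncard = (signPatterns fun i : Fin n => f i.succ).ncard +
      (signPatterns fun i : Fin n => (f i.succ).domRestrict (LinearMap.ker (f 0))).ncard := by
  set P : ℤˣ → Set (Fin n → ℤˣ) := fun s =>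
    {ε | (Fin.cons s ε : Fin (n + 1) → ℤˣ) ∈ signPatterns f}
  have hinj : ∀ s : ℤˣ,
      Function.Injective fun ε : Fin n → ℤˣ => (Fin.cons s ε : Fin (n + 1) → ℤˣ) :=
    fun s => Fin.cons_right_injective (α := fun _ => ℤˣ) s
  have hunion : signPatterns f = (fun ε : Fin n → ℤˣ => (Fin.cons 1 ε : Fin (n + 1) → ℤˣ)) '' P 1 ∪
      (fun ε : Fin n → ℤˣ => (Fin.cons (-1) ε : Fin (n + 1) → ℤˣ)) '' P (-1) := by
    ext ε
    constructor
    · intro h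
      rw [← Fin.cons_self_tail ε] at h ⊢
      rcases Int.units_eq_one_or (ε 0) with h1 | h1 <;> rw [h1] at h ⊢
      · exact .inl ⟨_, h, rfl⟩
      · exact .inr ⟨_, h, rfl⟩
    · rintro (⟨ε, h, rfl⟩ | ⟨ε, h, rfl⟩) <;> exact h
  have hdisj : Disjoint ((fun ε : Fin n → ℤˣ => (Fin.cons 1 ε : Fin (n + 1) → ℤˣ)) '' P 1)
      ((fun ε : Fin n → ℤˣ => (Fin.cons (-1) ε : Fin (n + 1) → ℤˣ)) '' P (-1)) := by
    rw [Set.disjoint_left]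
    rintro _ ⟨ε, -, rfl⟩ ⟨δ, -, h⟩
    have := congrFun h 0
    simp at this
  have h1 : signPatterns (fun i : Fin n => f i.succ) = P 1 ∪ P (-1) :=
    Set.ext fun ε => mem_signPatterns_tail_iff h0 ε
  have h2 : signPatterns (fun i : Fin n => (f i.succ).domRestrict (LinearMap.ker (f 0)))
      = P 1 ∩ P (-1) := Set.ext fun ε => mem_signPatterns_ker_iff h0 ε
  rw [hunion, Set.ncard_union_eq hdisj, Set.ncard_image_of_injective _ (hinj _),
    Set.ncard_image_of_injective _ (hinj _), h1, h2, Set.ncard_union_add_ncard_inter]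

lemma InGeneralPosition.tail {n d : ℕ} {f : Fin (n + 1) → V} (h : InGeneralPosition d f) :
    InGeneralPosition d fun i : Fin n => f i.succ := by
  intro S hS
  have := h (S.map (Fin.succEmb n)) (by simpa using hS)
  rw [Finset.coe_map] at this
  exact LinearIndepOn.comp_of_image this (Fin.succ_injective n).injOn

lemma InGeneralPosition.domRestrict_ker {n d : ℕ} {f : Fin (n + 1) → Module.Dual ℝ V}
    (h0 : f 0 ≠ 0) (h : InGeneralPosition (d + 1) f) :
    InGeneralPosition d fun i : Fin n => (f i.succ).domRestrict (LinearMap.ker (f 0)) := by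
  intro S hS
  obtain ⟨u, hu⟩ : ∃ u, f 0 u = 1 := LinearMap.surjective h0 1
  have hnot : (0 : Fin (n + 1)) ∉ S.map (Fin.succEmb n) := by simp [Fin.succ_ne_zero]
  have hT := h (insert 0 (S.map (Fin.succEmb n)))
    ((Finset.card_insert_le _ _).trans (by simpa using hS))
  rw [linearIndepOn_finset_iff] at hT ⊢
  intro c hc i hi
  -- A combination `F` vanishing on `ker (f 0)` is the multiple `F u • f 0` of `f 0`.
  set F : Module.Dual ℝ V := ∑ i ∈ S, c i • f i.succ
  have hF : F = F u • f 0 := by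
    ext v
    have hmem : v - f 0 v • u ∈ LinearMap.ker (f 0) := by simp [hu]
    have h1 := LinearMap.congr_fun hc ⟨_, hmem⟩
    have h2 : F (v - f 0 v • u) = 0 := by
      simpa [F, LinearMap.sum_apply] using h1
    rw [map_sub, map_smul, sub_eq_zero] at h2
    simp [h2, mul_comm]
  have := hT (Fin.cons (-F u) c) (by
    rw [Finset.sum_insert hnot, Finset.sum_map]
    simp only [Fin.cons_zero, Fin.coe_succEmb, Fin.cons_succ]
    change (-F u) • f 0 + F = 0
    ext v
    have := LinearMap.congr_fun hF v
    simp only [LinearMap.smul_apply, smul_eq_mul, LinearMap.add_apply,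
      LinearMap.zero_apply] at this ⊢
    linarith) i.succ (by simp [hi])
  simpa using this

end Patterns

/-- Functionals in general position on a space of dimension `d` realise
`2 * ∑ j < d, C(n, j)` sign patterns, `n + 1` being the number of functionals. -/
theorem ncard_signPatterns {V : Type*} [AddCommGroup V] [Module ℝ V] [FiniteDimensional ℝ V]
    (n d : ℕ) (hd : Module.finrank ℝ V = d) (f : Fin (n + 1) → Module.Dual ℝ V)
    (hf : InGeneralPosition d f) :
    (signPatterns f).ncard = 2 * ∑ j ∈ Finset.range d, n.choose j := by
  induction n generalizing V d with
  | zero => ?_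
  | succ n ih => ?_
  all_goals
    rcases d with _ | d
    · have : Subsingleton V := Module.finrank_zero_iff.1 hd
      have : signPatterns f = ∅ := by
        refine Set.eq_empty_of_forall_notMem ?_
        rintro ε ⟨v, hv⟩
        simpa [Subsingleton.elim v 0] using hv 0
      simp [this]
    have h0 : f 0 ≠ 0 := by
      have := hf {0} (by simp)
      rw [Finset.coe_singleton] at this
      exact this.ne_zero (Set.mem_singleton 0)
    rw [ncard_signPatterns_succ h0]
  · have huniv : ∀ {W : Type _} [AddCommGroup W] [Module ℝ W] (g : Fin 0 → Module.Dual ℝ W),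
        (signPatterns g).ncard = 1 := by
      intro W _ _ g
      have : signPatterns g = Set.univ := Set.eq_univ_of_forall fun ε => ⟨0, fun i => i.elim0⟩
      simp [this]
    have huniv' := huniv (fun i : Fin 0 => f i.succ)
    have huniv'' := huniv (fun i : Fin 0 => (f i.succ).domRestrict (LinearMap.ker (f 0)))
    rw [huniv', huniv'', Finset.sum_range_succ']
    simp
  · have hker : Module.finrank ℝ (LinearMap.ker (f 0)) = d := by
      have := Module.Dual.finrank_ker_add_one_of_ne_zero h0
      omega
    rw [ih (d + 1) hd _ hf.tail, ih d hker _ (hf.domRestrict_ker h0), ← mul_add,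
      Finset.sum_range_succ' _ d, Finset.sum_range_succ' _ d]
    simp only [Nat.choose_succ_succ, Finset.sum_add_distrib, Nat.choose_zero_right]
    ring

/-! ### Half-spaces, convex hulls and regions -/

section Geometry

variable {n d : ℕ}

theorem zero_notMem_convexHull_range_iff_lieInHalfSpace (hn : 1 ≤ n)
    (w : Fin n → EuclideanSpace ℝ (Fin d)) :
    (0 : EuclideanSpace ℝ (Fin d)) ∉ convexHull ℝ (Set.range w) ↔ LieInHalfSpace w := by
  constructor
  · intro h
    obtain ⟨g, u, hg0, hg⟩ := geometric_hahn_banach_point_closed (convex_convexHull ℝ _)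
      ((Set.finite_range w).isClosed_convexHull ℝ) h
    rw [map_zero] at hg0
    have hpos : ∀ i, 0 < inner ℝ ((InnerProductSpace.toDual ℝ _).symm g) (w i) := fun i => by
      rw [InnerProductSpace.toDual_symm_apply]
      exact hg0.trans (hg _ (subset_convexHull ℝ _ (Set.mem_range_self i)))
    refine ⟨_, fun h0 => ?_, hpos⟩
    have := hpos ⟨0, hn⟩
    rw [h0, inner_zero_left] at this
    exact lt_irrefl _ this
  · rintro ⟨v, -, hv⟩ h
    have hconv : Convex ℝ (openHalfSpace v) := by
      have := (convex_Ioi (0 : ℝ)).linear_preimage (innerₗ (EuclideanSpace ℝ (Fin d)) v)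
      exact this
    have := convexHull_min (Set.range_subset_iff.2 hv) hconv h
    simp [openHalfSpace] at this

lemma inner_units_smul_right (ε : ℤˣ) (v x : EuclideanSpace ℝ (Fin d)) :
    inner ℝ v (ε • x) = ε • (inner ℝ v x : ℝ) := by
  rcases Int.units_eq_one_or ε with rfl | rfl <;> simp [Units.smul_def]

lemma lieInHalfSpace_smul_iff_mem_signPatterns (hn : 1 ≤ n) (ε : Fin n → ℤˣ)
    (z : Fin n → EuclideanSpace ℝ (Fin d)) :
    LieInHalfSpace (fun i => ε i • z i) ↔ ε ∈ signPatterns fun i => innerₗ _ (z i) := by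
  simp only [LieInHalfSpace, openHalfSpace, signPatterns, Set.mem_ofPred_eq,
    inner_units_smul_right, innerₗ_apply_apply, real_inner_comm]
  refine exists_congr fun v => and_iff_right_of_imp fun h h0 => ?_
  simpa [h0] using h ⟨0, hn⟩

lemma lieInHalfSpace_neg_iff (w : Fin n → EuclideanSpace ℝ (Fin d)) :
    LieInHalfSpace (fun i => -w i) ↔ LieInHalfSpace w := by
  constructor <;> rintro ⟨v, hv0, hv⟩ <;>
    exact ⟨-v, neg_ne_zero.2 hv0, fun i => by simpa [openHalfSpace] using hv i⟩

lemma sum_halfSpaceIndicator (hn : 1 ≤ n) (z : Fin n → EuclideanSpace ℝ (Fin d)) :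
    ∑ ε : Fin n → ℤˣ, halfSpaceIndicator ε z = (signPatterns fun i => innerₗ _ (z i)).ncard := by
  classical
  simp only [halfSpaceIndicator, lieInHalfSpace_smul_iff_mem_signPatterns hn]
  rw [Finset.sum_boole, Set.ncard_eq_toFinset_card', Nat.cast_id]
  congr 1
  ext ε
  simp

/-- The regions of the arrangement correspond to the sign patterns: the sign vector of `⟨v, z i⟩`
is locally constant off the hyperplanes and its fibres are convex. -/
theorem numRegions_eq_ncard_signPatterns (z : Fin n → EuclideanSpace ℝ (Fin d)) :
    numRegions z = (signPatterns fun i => innerₗ _ (z i)).ncard := by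
  classical
  let E := EuclideanSpace ℝ (Fin d)
  let s : Set E := (⋃ i, {v : E | inner ℝ v (z i) = 0})ᶜ
  have hs : ∀ v : s, ∀ i, inner ℝ (z i) (v : E) ≠ (0 : ℝ) := fun v i h =>
    v.2 (Set.mem_iUnion.2 ⟨i, by rw [Set.mem_ofPred_eq, real_inner_comm]; exact h⟩)
  let σ : s → Fin n → ℤˣ := fun v i => if 0 < inner ℝ (z i) (v : E) then 1 else -1
  have hσ : ∀ v : s, ∀ i, 0 < σ v i • (inner ℝ (z i) (v : E) : ℝ) := by
    intro v i
    by_cases h : 0 < inner ℝ (z i) (v : E)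
    · simp [σ, h]
    · simpa [σ, h, Units.smul_def] using lt_of_le_of_ne (not_lt.1 h) (hs v i)
  have hσ' : ∀ (v : s) (ε : Fin n → ℤˣ),
      (∀ i, 0 < ε i • (inner ℝ (z i) (v : E) : ℝ)) → σ v = ε := by
    intro v ε h
    ext1 i
    have h1 := hσ v i
    have h2 := h i
    rcases Int.units_eq_one_or (σ v i) with h3 | h3 <;>
      rcases Int.units_eq_one_or (ε i) with h4 | h4 <;>
      rw [h3, h4] <;> simp only [h3, h4, Units.smul_def, Units.val_neg, Units.val_one, neg_smul,
        one_smul] at h1 h2 <;> linarith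
  have hlc : IsLocallyConstant σ := by
    rw [IsLocallyConstant.iff_eventually_eq]
    intro v
    have : ∀ᶠ w : s in nhds v, ∀ i, 0 < σ v i • (inner ℝ (z i) (w : E) : ℝ) := by
      rw [Filter.eventually_all]
      intro i
      have hc : Continuous fun w : s => σ v i • (inner ℝ (z i) (w : E) : ℝ) := by fun_prop
      exact (hc.tendsto v).eventually_const_lt (hσ v i)
    filter_upwards [this] with w hw using hσ' w _ hw
  have hfib : ∀ ε : Fin n → ℤˣ, IsPreconnected {v : s | σ v = ε} := by
    intro ε
    rw [← Topology.IsInducing.subtypeVal.isPreconnected_image]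
    have : Subtype.val '' {v : s | σ v = ε} = ⋂ i, {v : E | 0 < (ε i • innerₗ E (z i)) v} := by
      ext v
      simp only [Set.mem_image, Set.mem_iInter, Set.mem_ofPred_eq]
      constructor
      · rintro ⟨w, rfl, rfl⟩ i
        exact hσ w i
      · intro h
        have hv : v ∈ s := fun hv => by
          obtain ⟨i, hi⟩ := Set.mem_iUnion.1 hv
          have := h i
          rw [Set.mem_ofPred_eq, real_inner_comm] at hi
          simp [hi] at this
        exact ⟨⟨v, hv⟩, hσ' _ _ h, rfl⟩
    rw [this]
    exact (convex_iInter fun i =>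
      (convex_Ioi (0 : ℝ)).linear_preimage (ε i • innerₗ E (z i))).isPreconnected
  let Φ : ConnectedComponents s → signPatterns (fun i => innerₗ E (z i)) :=
    Quotient.lift (fun v => ⟨σ v, v, hσ v⟩) fun v w h => Subtype.ext
      (hlc.apply_eq_of_isPreconnected isPreconnected_connectedComponent mem_connectedComponent
        (connectedComponent_eq_iff_mem.1 h.symm))
  refine Nat.card_congr (Equiv.ofBijective Φ ⟨?_, ?_⟩)
  · intro a b
    refine Quotient.inductionOn₂ a b fun v w h => ?_
    have h' : σ v = σ w := congrArg Subtype.val h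
    exact ConnectedComponents.coe_eq_coe'.2
      ((hfib (σ w)).subset_connectedComponent (show σ w = σ w from rfl) h')
  · rintro ⟨ε, v, hv⟩
    have hvs : v ∈ s := fun h => by
      obtain ⟨i, hi⟩ := Set.mem_iUnion.1 h
      have := hv i
      rw [Set.mem_ofPred_eq, real_inner_comm] at hi
      simp [hi] at this
    exact ⟨ConnectedComponents.mk ⟨v, hvs⟩, Subtype.ext (hσ' ⟨v, hvs⟩ ε hv)⟩

lemma InGeneralPosition.map {M N ι : Type*} [AddCommGroup M] [Module ℝ M] [AddCommGroup N]
    [Module ℝ N] {k : ℕ} {x : ι → M} (h : InGeneralPosition k x) {g : M →ₗ[ℝ] N}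
    (hg : LinearMap.ker g = ⊥) : InGeneralPosition k fun i => g (x i) :=
  fun S hS => (h S hS).map' g hg

theorem sum_halfSpaceIndicator_of_inGeneralPosition (hn : 1 ≤ n)
    {z : Fin n → EuclideanSpace ℝ (Fin d)} (hz : InGeneralPosition d z) :
    ∑ ε : Fin n → ℤˣ, halfSpaceIndicator ε z = 2 * ∑ j ∈ Finset.range d, (n - 1).choose j := by
  obtain ⟨n, rfl⟩ := Nat.exists_eq_add_of_le' hn
  rw [sum_halfSpaceIndicator hn]
  refine ncard_signPatterns n d (by simp) _ (hz.map (g := innerₗ _) ?_)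
  rw [LinearMap.ker_eq_bot']
  intro x hx
  exact inner_self_eq_zero.1 (LinearMap.congr_fun hx x : inner ℝ x x = (0 : ℝ))

lemma isOpen_setOf_lieInHalfSpace :
    IsOpen {w : Fin n → EuclideanSpace ℝ (Fin d) | LieInHalfSpace w} := by
  have : {w : Fin n → EuclideanSpace ℝ (Fin d) | LieInHalfSpace w} =
      ⋃ (v) (_ : v ≠ 0), ⋂ i, {w | 0 < inner ℝ v (w i)} := by
    ext w
    simp [LieInHalfSpace, openHalfSpace]
  rw [this]
  exact isOpen_iUnion fun v => isOpen_iUnion fun _ => isOpen_iInter_of_finite fun i =>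
    isOpen_lt continuous_const (by fun_prop)

end Geometry

/-! ### Random points -/

section Random

variable {Ω : Type*} [MeasurableSpace Ω] {μ : Measure Ω} {n d : ℕ}

lemma HasSymmetricDensity.map_absolutelyContinuous {X : Ω → EuclideanSpace ℝ (Fin d)}
    (h : HasSymmetricDensity X μ) : μ.map X ≪ volume := by
  obtain ⟨-, f, -, -, hf⟩ := h
  rw [hf]
  exact withDensity_absolutelyContinuous _ _

lemma HasSymmetricDensity.map_neg {X : Ω → EuclideanSpace ℝ (Fin d)}
    (h : HasSymmetricDensity X μ) : μ.map (fun ω => -X ω) = μ.map X := by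
  obtain ⟨hX, f, hf, hsymm, hmap⟩ := h
  have h1 : μ.map (fun ω => -X ω) = (μ.map X).map Neg.neg :=
    (Measure.map_map measurable_neg hX).symm
  rw [h1, hmap]
  ext s hs
  rw [Measure.map_apply measurable_neg hs, withDensity_apply _ (measurable_neg hs),
    withDensity_apply _ hs]
  have := (Measure.measurePreserving_neg
    (volume : Measure (EuclideanSpace ℝ (Fin d)))).setLIntegral_comp_preimage hs hf
  simpa [hsymm] using this

lemma HasSymmetricDensity.map_units_smul {X : Ω → EuclideanSpace ℝ (Fin d)}
    (h : HasSymmetricDensity X μ) (ε : ℤˣ) : μ.map (fun ω => ε • X ω) = μ.map X := by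
  rcases Int.units_eq_one_or ε with rfl | rfl
  · simp
  · simpa [Units.smul_def] using h.map_neg

variable [IsProbabilityMeasure μ]

/-- Independent random points with absolutely continuous laws are almost surely in general
position, and this remains so if one index `k` is exempted, at which the point only has to be
nonzero. -/
theorem ae_inGeneralPosition {z : Fin n → Ω → EuclideanSpace ℝ (Fin d)} (hind : iIndepFun z μ)
    (hz : ∀ i, Measurable (z i)) (k : Fin n) (hk : ∀ᵐ ω ∂μ, z k ω ≠ 0)
    (hac : ∀ i, i ≠ k → μ.map (z i) ≪ volume) :
    ∀ᵐ ω ∂μ, InGeneralPosition d fun i => z i ω := by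
  classical
  unfold InGeneralPosition
  rw [ae_all_iff]
  intro S
  rw [Filter.eventually_imp_distrib_left]
  intro hS
  induction S using Finset.strongInduction with
  | H S ih =>
    -- Remove a point of index other than `k`, so that the exempted point comes first.
    by_cases hex : ∃ i ∈ S, i ≠ k
    · obtain ⟨i, hiS, hik⟩ := hex
      set T := S.erase i with hT
      have hiT : i ∉ T := Finset.notMem_erase i S
      have hcard : T.card < d := (Finset.card_lt_card (Finset.erase_ssubset hiS)).trans_le hS
      have ihT := ih T (Finset.erase_ssubset hiS) hcard.le
      have hSins : S = insert i T := (Finset.insert_erase hiS).symm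
      let E := EuclideanSpace ℝ (Fin d)
      let Y : Ω → T → E := fun ω j => z j ω
      have hY : Measurable Y := measurable_pi_lambda _ fun j => hz j
      have hindep : IndepFun Y (z i) μ := by
        have h := hind.indepFun_finset T {i} (by simpa using hiT) hz
        exact h.comp measurable_id
          (measurable_pi_apply (⟨i, Finset.mem_singleton_self i⟩ : ({i} : Finset (Fin n))))
      let B : Set ((T → E) × E) :=
        {p | LinearIndependent ℝ p.1 ∧ p.2 ∈ Submodule.span ℝ (Set.range p.1)}
      have hB : MeasurableSet B := by
        have h1 : MeasurableSet {y : T → E | LinearIndependent ℝ y} :=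
          isOpen_setOfPred_linearIndependent.measurableSet
        have h2 : MeasurableSet {y : Option T → E | LinearIndependent ℝ y} :=
          isOpen_setOfPred_linearIndependent.measurableSet
        have hm : Measurable fun p : (T → E) × E =>
            (fun o => Option.casesOn' o p.2 p.1 : Option T → E) :=
          measurable_pi_lambda _ fun o => by
            cases o
            · exact measurable_snd
            · exact (measurable_pi_apply _).comp measurable_fst
        have hBeq : B = (Prod.fst ⁻¹' {y : T → E | LinearIndependent ℝ y}) \
            ((fun p : (T → E) × E => (fun o => Option.casesOn' o p.2 p.1 : Option T → E)) ⁻¹'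
              {y | LinearIndependent ℝ y}) := by
          ext p
          simp only [B, Set.mem_ofPred_eq, Set.mem_sdiff, Set.mem_preimage,
            linearIndependent_option']
          tauto
        rw [hBeq]
        exact (measurable_fst h1).diff (hm h2)
      have hnull : (μ.map fun ω => (Y ω, z i ω)) B = 0 := by
        rw [(indepFun_iff_map_prod_eq_prod_map_map hY.aemeasurable (hz i).aemeasurable).1 hindep,
          Measure.measure_prod_null hB]
        refine Filter.Eventually.of_forall fun y => hac i hik ?_
        refine measure_mono_null (t := (Submodule.span ℝ (Set.range y) : Set E))
          (fun x hx => hx.2) (Measure.addHaar_submodule _ _ fun htop => ?_)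
        have h1 := finrank_range_le_card (R := ℝ) y
        rw [Set.finrank, htop, finrank_top, finrank_euclideanSpace_fin, Fintype.card_coe] at h1
        omega
      rw [Measure.map_apply (hY.prodMk (hz i)) hB] at hnull
      filter_upwards [ihT, measure_eq_zero_iff_ae_notMem.1 hnull] with ω h1 h2
      rw [hSins, Finset.coe_insert, linearIndepOn_insert (by simpa using hiT)]
      refine ⟨h1, fun h3 => h2 ⟨h1, ?_⟩⟩
      rwa [Set.image_eq_range] at h3
    · push Not at hex
      filter_upwards [hk] with ω hω
      exact (LinearIndepOn.singleton (v := fun i => z i ω) (i := k) hω).mono fun i hi => hex i hi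

/-- Averaging over sign changes: if they do not affect the probability of lying in a half-space,
that probability is the almost sure number of favourable sign vectors, divided by `2 ^ n`. -/
theorem measureReal_zero_notMem_convexHull (hn : 1 ≤ n)
    {z : Fin n → Ω → EuclideanSpace ℝ (Fin d)} (hz : ∀ i, Measurable (z i))
    (hgp : ∀ᵐ ω ∂μ, InGeneralPosition d fun i => z i ω)
    (hsymm : ∀ ε : Fin n → ℤˣ, μ {ω | LieInHalfSpace fun i => ε i • z i ω} =
      μ {ω | LieInHalfSpace fun i => z i ω}) :
    μ.real {ω | (0 : EuclideanSpace ℝ (Fin d)) ∉ convexHull ℝ (Set.range fun i => z i ω)}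
      = (1 / 2 ^ (n - 1)) * ∑ j ∈ Finset.range d, ((n - 1).choose j : ℝ) := by
  classical
  simp only [zero_notMem_convexHull_range_iff_lieInHalfSpace hn]
  have hmeas : ∀ ε : Fin n → ℤˣ, MeasurableSet {ω | LieInHalfSpace fun i => ε i • z i ω} := by
    intro ε
    have hm : Measurable fun ω i => ε i • z i ω :=
      measurable_pi_lambda _ fun i => by
        simp only [Units.smul_def]
        exact (hz i).const_smul _
    exact hm isOpen_setOf_lieInHalfSpace.measurableSet
  have hind : ∀ ε : Fin n → ℤˣ, (fun ω => (halfSpaceIndicator ε (fun i => z i ω) : ℝ)) =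
      {ω | LieInHalfSpace fun i => ε i • z i ω}.indicator 1 := by
    intro ε
    ext ω
    by_cases h : LieInHalfSpace fun i => ε i • z i ω <;> simp [halfSpaceIndicator, h]
  have hint : ∀ ε : Fin n → ℤˣ, ∫ ω, (halfSpaceIndicator ε (fun i => z i ω) : ℝ) ∂μ =
      μ.real {ω | LieInHalfSpace fun i => z i ω} := by
    intro ε
    rw [hind, integral_indicator_one (hmeas ε), Measure.real, hsymm ε, Measure.real]
  have hintegrable : ∀ ε : Fin n → ℤˣ,
      Integrable (fun ω => (halfSpaceIndicator ε (fun i => z i ω) : ℝ)) μ := by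
    intro ε
    rw [hind]
    exact (integrable_const (1 : ℝ)).indicator (hmeas ε)
  have h1 : ∫ ω, ∑ ε : Fin n → ℤˣ, (halfSpaceIndicator ε (fun i => z i ω) : ℝ) ∂μ =
      2 ^ n * μ.real {ω | LieInHalfSpace fun i => z i ω} := by
    rw [integral_finsetSum _ fun ε _ => hintegrable ε]
    simp [hint]
  have h2 : ∫ ω, ∑ ε : Fin n → ℤˣ, (halfSpaceIndicator ε (fun i => z i ω) : ℝ) ∂μ =
      2 * ∑ j ∈ Finset.range d, ((n - 1).choose j : ℝ) := by
    have : (fun ω => ∑ ε : Fin n → ℤˣ, (halfSpaceIndicator ε (fun i => z i ω) : ℝ)) =ᵐ[μ]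
        fun _ => 2 * ∑ j ∈ Finset.range d, ((n - 1).choose j : ℝ) := by
      filter_upwards [hgp] with ω hω
      exact_mod_cast sum_halfSpaceIndicator_of_inGeneralPosition hn hω
    rw [integral_congr_ae this]
    simp
  rw [h1] at h2
  obtain ⟨m, rfl⟩ := Nat.exists_eq_add_of_le' hn
  rw [pow_succ, mul_comm _ (2 : ℝ), mul_assoc] at h2
  rw [Nat.add_sub_cancel] at h2 ⊢
  rw [one_div, eq_inv_mul_iff_mul_eq₀ (by positivity)]
  exact mul_left_cancel₀ two_ne_zero h2

/-- Sign changes that preserve each marginal law preserve the joint law, by independence. -/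
lemma measure_lieInHalfSpace_units_smul {z : Fin n → Ω → EuclideanSpace ℝ (Fin d)}
    (hind : iIndepFun z μ) (hz : ∀ i, Measurable (z i)) {ε : Fin n → ℤˣ}
    (hε : ∀ i, μ.map (fun ω => ε i • z i ω) = μ.map (z i)) :
    μ {ω | LieInHalfSpace fun i => ε i • z i ω} = μ {ω | LieInHalfSpace fun i => z i ω} := by
  have hsm : ∀ i, Measurable fun x : EuclideanSpace ℝ (Fin d) => ε i • x := fun i => by
    simp only [Units.smul_def]
    exact measurable_const_smul _
  have hzε : ∀ i, Measurable fun ω => ε i • z i ω := fun i => (hsm i).comp (hz i)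
  have hindε : iIndepFun (fun i ω => ε i • z i ω) μ := hind.comp _ hsm
  have hlaw : μ.map (fun ω i => ε i • z i ω) = μ.map fun ω i => z i ω := by
    rw [(iIndepFun_iff_map_fun_eq_pi_map fun i => (hzε i).aemeasurable).1 hindε,
      (iIndepFun_iff_map_fun_eq_pi_map fun i => (hz i).aemeasurable).1 hind]
    simp only [hε]
  have hopen : MeasurableSet {w : Fin n → EuclideanSpace ℝ (Fin d) | LieInHalfSpace w} :=
    isOpen_setOf_lieInHalfSpace.measurableSet
  have h1 := Measure.map_apply (μ := μ) (measurable_pi_lambda _ hzε) hopen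
  have h2 := Measure.map_apply (μ := μ) (measurable_pi_lambda _ hz) hopen
  exact h1.symm.trans ((congrArg (fun ν => ν {w | LieInHalfSpace w}) hlaw).trans h2)

end Random

theorem mainTheorem1 (n d : ℕ) (hn : 1 ≤ n) (hd : 1 ≤ d)
    {Ω : Type*} [MeasurableSpace Ω] (μ : Measure Ω) [IsProbabilityMeasure μ] :
    -- the two descriptions of the event agree for every configuration of points
    (∀ w : Fin n → EuclideanSpace ℝ (Fin d),
      (0 : EuclideanSpace ℝ (Fin d)) ∉ convexHull ℝ (Set.range w) ↔ LieInHalfSpace w) ∧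
    -- the formula and the almost sure region count, for independent random points
    (∀ z : Fin n → Ω → EuclideanSpace ℝ (Fin d), iIndepFun z μ →
      (∀ i, HasSymmetricDensity (z i) μ) →
      μ.real {ω | (0 : EuclideanSpace ℝ (Fin d)) ∉ convexHull ℝ (Set.range fun i => z i ω)}
          = (1 / 2 ^ (n - 1)) * ∑ j ∈ Finset.range d, ((n - 1).choose j : ℝ) ∧
      ∀ᵐ ω ∂μ,
        ∑ ε : Fin n → ℤˣ, halfSpaceIndicator ε (fun i => z i ω)
            = numRegions (fun i => z i ω) ∧
        numRegions (fun i => z i ω) = 2 * ∑ j ∈ Finset.range d, (n - 1).choose j) ∧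
    -- the formula persists when one of the points is a fixed nonzero point
    (∀ (z : Fin n → Ω → EuclideanSpace ℝ (Fin d)) (k : Fin n) (a : EuclideanSpace ℝ (Fin d)),
      a ≠ 0 → (∀ ω, z k ω = a) → iIndepFun z μ →
      (∀ i, i ≠ k → HasSymmetricDensity (z i) μ) →
      μ.real {ω | (0 : EuclideanSpace ℝ (Fin d)) ∉ convexHull ℝ (Set.range fun i => z i ω)}
          = (1 / 2 ^ (n - 1)) * ∑ j ∈ Finset.range d, ((n - 1).choose j : ℝ)) := by
  refine ⟨zero_notMem_convexHull_range_iff_lieInHalfSpace hn, ?_, ?_⟩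
  · intro z hind hz
    have hmeas : ∀ i, Measurable (z i) := fun i => (hz i).1
    have hne : ∀ᵐ ω ∂μ, z ⟨0, hn⟩ ω ≠ 0 := by
      have : Nonempty (Fin d) := ⟨⟨0, hd⟩⟩
      exact ae_of_ae_map (p := fun x => x ≠ 0) (hmeas _).aemeasurable
        ((hz _).map_absolutelyContinuous.ae_le (compl_mem_ae_iff.2 (measure_singleton 0)))
    have hgp := ae_inGeneralPosition hind hmeas ⟨0, hn⟩ hne fun i _ =>
      (hz i).map_absolutelyContinuous
    refine ⟨measureReal_zero_notMem_convexHull hn hmeas hgp fun ε =>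
      measure_lieInHalfSpace_units_smul hind hmeas fun i => (hz i).map_units_smul _, ?_⟩
    filter_upwards [hgp] with ω hω
    have hsum : ∑ ε : Fin n → ℤˣ, halfSpaceIndicator ε (fun i => z i ω) =
        numRegions fun i => z i ω := by
      rw [sum_halfSpaceIndicator hn, numRegions_eq_ncard_signPatterns]
    exact ⟨hsum, hsum ▸ sum_halfSpaceIndicator_of_inGeneralPosition hn hω⟩
  · intro z k a ha hk hind hz
    have hzk : z k = fun _ => a := funext hk
    have hmeas : ∀ i, Measurable (z i) := fun i => by
      by_cases h : i = k
      · rw [h, hzk]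
        exact measurable_const
      · exact (hz i h).1
    have hgp := ae_inGeneralPosition hind hmeas k (by simp [hk, ha]) fun i hi =>
      (hz i hi).map_absolutelyContinuous
    -- A sign vector fixing the `k`-th point preserves the joint law.
    have hfix : ∀ ε : Fin n → ℤˣ, ε k = 1 → μ {ω | LieInHalfSpace fun i => ε i • z i ω} =
        μ {ω | LieInHalfSpace fun i => z i ω} := fun ε hε =>
      measure_lieInHalfSpace_units_smul hind hmeas fun i => by
        by_cases h : i = k
        · simp [h, hε]
        · exact (hz i h).map_units_smul _
    refine measureReal_zero_notMem_convexHull hn hmeas hgp fun ε => ?_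
    rcases Int.units_eq_one_or (ε k) with h | h
    · exact hfix ε h
    · -- Negating the whole configuration reduces to the case `ε k = 1`.
      rw [← hfix (-ε) (by simp [h])]
      congr 1
      ext ω
      simpa using (lieInHalfSpace_neg_iff fun i => ε i • z i ω).symm
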